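/- Let $G$ be an abelian group. For a topological space $Y$, a subset $Y_0\subseteq Y$ and an integer $n\ge 0$, let $H^n(Y,Y_0;G)$ denote the relative singular cohomology group with coefficients in $G$. For a Hausdorff pair $(X,X_0)$, that is, a Hausdorff space $X$ with an arbitrary subset $X_0\subseteq X$, let $c(X,X_0)$ be the set of pairs $(K,K_0)$ of compact sets with $K_0\subseteq K\subseteq X$ and $K_0\subseteq X_0$, directed by $(K,K_0)\le(K',K_0')$ if and only if $K\subseteq K'$ and $K_0\subseteq K_0'$. The $n$-th CH-shape cohomology group of $(X,X_0)$ is the inverse limit $$\hat H^n(X,X_0;G)=\varprojlim_{(K,K_0)\in c(X,X_0)}H^n(K,K_0;G),$$ whose bonding homomorphisms are induced by the inclusions $(K,K_0)\hookrightarrow(K',K_0')$. A continuous map of Hausdorff pairs $\varphi:(X,X_0)\to(Y,Y_0)$ induces the homomorphism $\hat\varphi^n:\hat H^n(Y,Y_0;G)\to\hat H^n(X,X_0;G)$ sending a compatible family $(y_{(L,L_0)})$ to the family whose component at $(K,K_0)$ is $(\varphi|_K)^*\,y_{(\varphi(K),\varphi(K_0))}$, where $\varphi|_K:(K,K_0)\to(\varphi(K),\varphi(K_0))$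 is the restriction of $\varphi$. **Theorem (Excision).** Let $(X,X_0)$ be a Hausdorff pair and let $W\subseteq X$ be an open set with $\overline W\subseteq\operatorname{int}X_0$. Then for every abelian group $G$ and every integer $n\ge 0$ the homomorphism $$\hat i^n:\hat H^n(X,X_0;G)\to\hat H^n(X\setminus W,X_0\setminus W;G)$$ induced by the inclusion $i:(X\setminus W,X_0\setminus W)\to(X,X_0)$ is an isomorphism. -/

import Mathlib

open Topology

noncomputable section

/-! ## Singular chains -/

namespace Singular

universe u v w

/-- The standard topological `n`-simplex. -/
abbrev Simplex (n : ℕ) : Type := stdSimplex ℝ (Fin (n + 1))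

/-- The inclusion of the `i`-th face of the standard `(n+1)`-simplex: the affine map sending the
vertices `0, …, n` in order to the vertices of the `(n+1)`-simplex other than `i`. -/
def faceInclusion (n : ℕ) (i : Fin (n + 2)) : C(Simplex n, Simplex (n + 1)) :=
  ⟨stdSimplex.map i.succAbove, stdSimplex.continuous_map _⟩

/-- Singular `n`-chains of `X`: the free abelian group on the continuous maps `Δⁿ → X`. -/
abbrev Chain (X : Type u) [TopologicalSpace X] (n : ℕ) : Type u :=
  C(Simplex n, X) →₀ ℤ

/-- The singular boundary operator `∂ σ = ∑ i, (-1)^i • (σ ∘ dᵢ)`. -/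
def boundary (X : Type u) [TopologicalSpace X] (n : ℕ) : Chain X (n + 1) →ₗ[ℤ] Chain X n :=
  ∑ i : Fin (n + 2),
    (-1 : ℤ) ^ (i : ℕ) • Finsupp.lmapDomain ℤ ℤ (fun σ => σ.comp (faceInclusion n i))

/-- The homomorphism of chain groups induced by a continuous map. -/
def chainMap {X : Type u} {Y : Type v} [TopologicalSpace X] [TopologicalSpace Y]
    (f : C(X, Y)) (n : ℕ) : Chain X n →ₗ[ℤ] Chain Y n :=
  Finsupp.lmapDomain ℤ ℤ (fun σ => f.comp σ)

section chains

variable {X : Type u} {Y : Type v} {Z : Type w}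
  [TopologicalSpace X] [TopologicalSpace Y] [TopologicalSpace Z]

theorem boundary_single (n : ℕ) (σ : C(Simplex (n + 1), X)) :
    boundary X n (Finsupp.single σ 1) =
      ∑ i : Fin (n + 2),
        (-1 : ℤ) ^ (i : ℕ) • Finsupp.single (σ.comp (faceInclusion n i)) (1 : ℤ) := by
  simp [boundary, LinearMap.sum_apply]

theorem chainMap_single (f : C(X, Y)) (n : ℕ) (σ : C(Simplex n, X)) :
    chainMap f n (Finsupp.single σ 1) = Finsupp.single (f.comp σ) 1 := by
  simp [chainMap]

theorem chain_hom_ext {M : Type*} [AddCommGroup M] {n : ℕ} {φ ψ : Chain X n →ₗ[ℤ] M}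
    (h : ∀ σ, φ (Finsupp.single σ 1) = ψ (Finsupp.single σ 1)) : φ = ψ := by
  refine Finsupp.lhom_ext' fun σ => LinearMap.ext_ring ?_
  simpa using h σ

theorem boundary_comp_boundary (n : ℕ) : boundary X n ∘ₗ boundary X (n + 1) = 0 := by
  refine chain_hom_ext fun σ => ?_
  simp only [LinearMap.comp_apply, boundary_single, map_sum, map_zsmul, Finset.smul_sum,
    smul_smul, LinearMap.zero_apply, ← Finset.sum_product']
  refine Finset.sum_involution (fun p _ => (p.1.succAbove p.2, p.2.predAbove p.1)) ?_ ?_ ?_ ?_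
  · rintro ⟨i, j⟩ -
    have hface : (σ.comp (faceInclusion (n + 1) (i.succAbove j))).comp
        (faceInclusion n (j.predAbove i)) =
        (σ.comp (faceInclusion (n + 1) i)).comp (faceInclusion n j) := by
      ext x
      simp only [faceInclusion, ContinuousMap.comp_apply, ContinuousMap.coe_mk,
        stdSimplex.map_comp_apply]
      congr 2
      funext k
      exact Fin.succAbove_succAbove_succAbove_predAbove i j k
    have hsign : (-1 : ℤ) ^ ((i.succAbove j : Fin (n + 3)) : ℕ) *
        (-1) ^ ((j.predAbove i : Fin (n + 2)) : ℕ) = -((-1) ^ (i : ℕ) * (-1) ^ (j : ℕ)) := by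
      rw [← pow_add, ← pow_add]
      rcases lt_or_ge j.castSucc i with h | h
      · rw [Fin.succAbove_of_castSucc_lt _ _ h, Fin.predAbove_of_castSucc_lt _ _ h]
        have : (i : ℕ) = (i.pred (Fin.ne_zero_of_lt h) : ℕ) + 1 := by
          have := Fin.val_pred i (Fin.ne_zero_of_lt h)
          have h' : (j : ℕ) < i := h
          omega
        rw [this, Fin.val_castSucc]
        ring
      · rw [Fin.succAbove_of_le_castSucc _ _ h, Fin.predAbove_of_le_castSucc _ _ h,
          Fin.val_succ, Fin.coe_castPred]
        ring
    rw [hface, hsign, neg_smul, add_neg_cancel]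
  · rintro ⟨i, j⟩ - - h
    exact Fin.succAbove_ne i j (congrArg Prod.fst h)
  · rintro ⟨i, j⟩ -
    simp
  · rintro ⟨i, j⟩ -
    refine Prod.ext (Fin.succAbove_succAbove_predAbove i j) ?_
    exact Fin.predAbove_predAbove_succAbove i j

theorem chainMap_comp_boundary (f : C(X, Y)) (n : ℕ) :
    chainMap f n ∘ₗ boundary X n = boundary Y n ∘ₗ chainMap f (n + 1) := by
  refine chain_hom_ext fun σ => ?_
  simp only [LinearMap.comp_apply, boundary_single, chainMap_single, map_sum, map_zsmul,
    ContinuousMap.comp_assoc]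

theorem chainMap_id (n : ℕ) : chainMap (ContinuousMap.id X) n = LinearMap.id :=
  chain_hom_ext fun σ => by simp [chainMap_single]

theorem chainMap_comp (g : C(Y, Z)) (f : C(X, Y)) (n : ℕ) :
    chainMap (g.comp f) n = chainMap g n ∘ₗ chainMap f n :=
  chain_hom_ext fun σ => by simp [chainMap_single, ContinuousMap.comp_assoc]

end chains

/-! ## Relative singular cohomology -/

/-- Relative singular `n`-cochains of the pair `(X, A)` with coefficients in `G`: homomorphisms
`Cₙ(X) → G` vanishing on the singular simplices with image in `A`; that is, `Hom(Cₙ(X, A), G)`. -/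
def cochain (X : Type u) [TopologicalSpace X] (A : Set X) (G : Type w) [AddCommGroup G] (n : ℕ) :
    Submodule ℤ (Chain X n →ₗ[ℤ] G) where
  carrier := {φ | ∀ σ : C(Simplex n, X), (∀ t, σ t ∈ A) → φ (Finsupp.single σ 1) = 0}
  zero_mem' := fun _ _ => rfl
  add_mem' := fun {φ ψ} hφ hψ σ hσ => by simp [hφ σ hσ, hψ σ hσ]
  smul_mem' := fun c φ hφ σ hσ => by simp [hφ σ hσ]

section cochains

variable {X : Type u} {Y : Type v} [TopologicalSpace X] [TopologicalSpace Y]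

theorem comp_boundary_mem {A : Set X} {G : Type w} [AddCommGroup G] {n : ℕ}
    {φ : Chain X n →ₗ[ℤ] G} (hφ : φ ∈ cochain X A G n) :
    φ ∘ₗ boundary X n ∈ cochain X A G (n + 1) := by
  intro σ hσ
  rw [LinearMap.comp_apply, boundary_single, map_sum]
  refine Finset.sum_eq_zero fun i _ => ?_
  rw [map_zsmul, hφ _ fun t => hσ _, smul_zero]

theorem comp_chainMap_mem {A : Set X} {B : Set Y} {G : Type w} [AddCommGroup G] {n : ℕ}
    (f : C(X, Y)) (hf : Set.MapsTo f A B)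
    {φ : Chain Y n →ₗ[ℤ] G} (hφ : φ ∈ cochain Y B G n) :
    φ ∘ₗ chainMap f n ∈ cochain X A G n := by
  intro σ hσ
  rw [LinearMap.comp_apply, chainMap_single]
  exact hφ _ fun t => hf (hσ t)

end cochains

/-- The coboundary operator `δ φ = φ ∘ ∂` on relative singular cochains. -/
def coboundary (X : Type u) [TopologicalSpace X] (A : Set X) (G : Type w) [AddCommGroup G]
    (n : ℕ) : cochain X A G n →ₗ[ℤ] cochain X A G (n + 1) where
  toFun φ := ⟨φ.1 ∘ₗ boundary X n, comp_boundary_mem φ.2⟩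
  map_add' _ _ := rfl
  map_smul' _ _ := rfl

theorem coboundary_comp_coboundary (X : Type u) [TopologicalSpace X] (A : Set X) (G : Type w)
    [AddCommGroup G] (n : ℕ) : coboundary X A G (n + 1) ∘ₗ coboundary X A G n = 0 := by
  ext1 φ
  refine Subtype.ext ?_
  change (φ.1 ∘ₗ boundary X n) ∘ₗ boundary X (n + 1) = 0
  rw [LinearMap.comp_assoc, boundary_comp_boundary, LinearMap.comp_zero]

/-- Relative singular `n`-cocycles. -/
def cocycles (X : Type u) [TopologicalSpace X] (A : Set X) (G : Type w) [AddCommGroup G] (n : ℕ) :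
    Submodule ℤ (cochain X A G n) :=
  LinearMap.ker (coboundary X A G n)

/-- Relative singular `n`-coboundaries (zero for `n = 0`). -/
def coboundaries (X : Type u) [TopologicalSpace X] (A : Set X) (G : Type w) [AddCommGroup G] :
    (n : ℕ) → Submodule ℤ (cochain X A G n)
  | 0 => ⊥
  | n + 1 => LinearMap.range (coboundary X A G n)

theorem coboundaries_le_cocycles (X : Type u) [TopologicalSpace X] (A : Set X) (G : Type w)
    [AddCommGroup G] (n : ℕ) : coboundaries X A G n ≤ cocycles X A G n := by
  cases n with
  | zero => exact bot_le
  | succ n =>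
    rintro _ ⟨φ, rfl⟩
    exact LinearMap.congr_fun (coboundary_comp_coboundary X A G n) φ

/-- The relative singular cohomology group `Hⁿ(X, A; G)`: cocycles modulo coboundaries. -/
abbrev Cohomology (X : Type u) [TopologicalSpace X] (A : Set X) (G : Type w) [AddCommGroup G]
    (n : ℕ) : Type (max u w) :=
  cocycles X A G n ⧸ (coboundaries X A G n).submoduleOf (cocycles X A G n)

/-- The quotient group structure, recorded to shorten instance search. -/
instance (X : Type u) [TopologicalSpace X] (A : Set X) (G : Type w) [AddCommGroup G] (n : ℕ) :
    AddCommGroup (Cohomology X A G n) :=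
  Submodule.Quotient.addCommGroup _

section functoriality

variable {X : Type u} {Y : Type v} {Z : Type*}
  [TopologicalSpace X] [TopologicalSpace Y] [TopologicalSpace Z]
  {A : Set X} {B : Set Y} {D : Set Z}

/-- Pull-back of relative cochains along a continuous map of pairs `f : (X, A) → (Y, B)`. -/
def cochainMap (f : C(X, Y)) (hf : Set.MapsTo f A B) (G : Type w) [AddCommGroup G] (n : ℕ) :
    cochain Y B G n →ₗ[ℤ] cochain X A G n where
  toFun φ := ⟨φ.1 ∘ₗ chainMap f n, comp_chainMap_mem f hf φ.2⟩
  map_add' _ _ := rfl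
  map_smul' _ _ := rfl

theorem coboundary_cochainMap (f : C(X, Y)) (hf : Set.MapsTo f A B) (G : Type w) [AddCommGroup G]
    (n : ℕ) (φ : cochain Y B G n) :
    coboundary X A G n (cochainMap f hf G n φ) =
      cochainMap f hf G (n + 1) (coboundary Y B G n φ) := by
  refine Subtype.ext ?_
  change (φ.1 ∘ₗ chainMap f n) ∘ₗ boundary X n = (φ.1 ∘ₗ boundary Y n) ∘ₗ chainMap f (n + 1)
  rw [LinearMap.comp_assoc, chainMap_comp_boundary, LinearMap.comp_assoc]

theorem cochainMap_mem_cocycles (f : C(X, Y)) (hf : Set.MapsTo f A B) (G : Type w)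
    [AddCommGroup G] (n : ℕ) (φ : cochain Y B G n) (hφ : φ ∈ cocycles Y B G n) :
    cochainMap f hf G n φ ∈ cocycles X A G n := by
  rw [cocycles, LinearMap.mem_ker] at hφ ⊢
  rw [coboundary_cochainMap, hφ, map_zero]

theorem cochainMap_mem_coboundaries (f : C(X, Y)) (hf : Set.MapsTo f A B) (G : Type w)
    [AddCommGroup G] (n : ℕ) (φ : cochain Y B G n) (hφ : φ ∈ coboundaries Y B G n) :
    cochainMap f hf G n φ ∈ coboundaries X A G n := by
  cases n with
  | zero =>
    rw [coboundaries, Submodule.mem_bot] at hφ ⊢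
    rw [hφ, map_zero]
  | succ n =>
    obtain ⟨ψ, rfl⟩ := hφ
    exact ⟨cochainMap f hf G n ψ, coboundary_cochainMap f hf G n ψ⟩

/-- The restriction of `cochainMap` to cocycles. -/
def cocyclesMap (f : C(X, Y)) (hf : Set.MapsTo f A B) (G : Type w) [AddCommGroup G] (n : ℕ) :
    cocycles Y B G n →ₗ[ℤ] cocycles X A G n :=
  (cochainMap f hf G n).restrict (cochainMap_mem_cocycles f hf G n)

/-- The homomorphism `f* : Hⁿ(Y, B; G) → Hⁿ(X, A; G)` induced by a continuous map of pairs. -/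
def cohomologyMap (f : C(X, Y)) (hf : Set.MapsTo f A B) (G : Type w) [AddCommGroup G] (n : ℕ) :
    Cohomology Y B G n →ₗ[ℤ] Cohomology X A G n :=
  Submodule.mapQ _ _ (cocyclesMap f hf G n)
    fun φ hφ => cochainMap_mem_coboundaries f hf G n φ.1 hφ

theorem cohomologyMap_id (G : Type w) [AddCommGroup G] (n : ℕ) (x : Cohomology X A G n) :
    cohomologyMap (ContinuousMap.id X) (Set.mapsTo_id A) G n x = x := by
  obtain ⟨φ, rfl⟩ := Submodule.Quotient.mk_surjective _ x
  refine congrArg Submodule.Quotient.mk (Subtype.ext (Subtype.ext ?_))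
  change φ.1.1 ∘ₗ chainMap (ContinuousMap.id X) n = φ.1.1
  rw [chainMap_id, LinearMap.comp_id]

theorem cohomologyMap_comp (g : C(Y, Z)) (hg : Set.MapsTo g B D) (f : C(X, Y))
    (hf : Set.MapsTo f A B) (G : Type w) [AddCommGroup G]
    (n : ℕ) (x : Cohomology Z D G n) :
    cohomologyMap (g.comp f) (hg.comp hf) G n x = cohomologyMap f hf G n (cohomologyMap g hg G n x) := by
  obtain ⟨φ, rfl⟩ := Submodule.Quotient.mk_surjective _ x
  refine congrArg Submodule.Quotient.mk (Subtype.ext (Subtype.ext ?_))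
  change φ.1.1 ∘ₗ chainMap (g.comp f) n = (φ.1.1 ∘ₗ chainMap g n) ∘ₗ chainMap f n
  rw [chainMap_comp, LinearMap.comp_assoc]

end functoriality

end Singular

/-! ## CH-shape cohomology -/

namespace CHShape

open Singular

universe u v w

/-- A compact subpair `(K, K₀)` of the pair `(X, X₀)`. -/
@[ext]
structure CompactSubpair (X : Type u) [TopologicalSpace X] (X₀ : Set X) where
  /-- the ambient compact subset -/
  K : Set X
  /-- the smaller compact subset -/
  K₀ : Set X
  isCompact : IsCompact K
  isCompact₀ : IsCompact K₀
  subset : K₀ ⊆ K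
  subset₀ : K₀ ⊆ X₀

/-- Compact subpairs are ordered by inclusion of both components. -/
instance (X : Type u) [TopologicalSpace X] (X₀ : Set X) : PartialOrder (CompactSubpair X X₀) where
  le a b := a.K ⊆ b.K ∧ a.K₀ ⊆ b.K₀
  le_refl _ := ⟨subset_rfl, subset_rfl⟩
  le_trans _ _ _ h h' := ⟨h.1.trans h'.1, h.2.trans h'.2⟩
  le_antisymm _ _ h h' := CompactSubpair.ext (h.1.antisymm h'.1) (h.2.antisymm h'.2)

namespace CompactSubpair

variable {X : Type u} {Y : Type v} [TopologicalSpace X] [TopologicalSpace Y]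
  {X₀ : Set X} {Y₀ : Set Y}

/-- Compact subpairs form a directed set. -/
instance : IsDirectedOrder (CompactSubpair X X₀) where
  directed a b :=
    ⟨⟨a.K ∪ b.K, a.K₀ ∪ b.K₀, a.isCompact.union b.isCompact, a.isCompact₀.union b.isCompact₀,
      Set.union_subset_union a.subset b.subset, Set.union_subset a.subset₀ b.subset₀⟩,
      ⟨Set.subset_union_left, Set.subset_union_left⟩,
      ⟨Set.subset_union_right, Set.subset_union_right⟩⟩

/-- `K₀` viewed as a subset of the space `K`. -/
def sub (a : CompactSubpair X X₀) : Set a.K := Subtype.val ⁻¹' a.K₀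

/-- The inclusion map `K → K'` for `(K, K₀) ≤ (K', K₀')`. -/
def incl {a b : CompactSubpair X X₀} (h : a ≤ b) : C(a.K, b.K) :=
  ⟨Set.inclusion h.1, continuous_inclusion h.1⟩

theorem incl_mapsTo {a b : CompactSubpair X X₀} (h : a ≤ b) :
    Set.MapsTo (incl h) a.sub b.sub :=
  fun _ hx => h.2 hx

/-- The image `(f(K), f(K₀))` of a compact subpair under a map of pairs `f : (X, X₀) → (Y, Y₀)`. -/
def map (f : C(X, Y)) (hf : Set.MapsTo f X₀ Y₀) (a : CompactSubpair X X₀) :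
    CompactSubpair Y Y₀ where
  K := f '' a.K
  K₀ := f '' a.K₀
  isCompact := a.isCompact.image f.continuous
  isCompact₀ := a.isCompact₀.image f.continuous
  subset := Set.image_mono a.subset
  subset₀ := (Set.image_mono a.subset₀).trans hf.image_subset

theorem map_mono (f : C(X, Y)) (hf : Set.MapsTo f X₀ Y₀) {a b : CompactSubpair X X₀}
    (h : a ≤ b) : a.map f hf ≤ b.map f hf :=
  ⟨Set.image_mono h.1, Set.image_mono h.2⟩

/-- The restriction `(K, K₀) → (f(K), f(K₀))` of a map of pairs `f`. -/
def restr (f : C(X, Y)) (hf : Set.MapsTo f X₀ Y₀) (a : CompactSubpair X X₀) :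
    C(a.K, (a.map f hf).K) :=
  ⟨fun x => ⟨f x, Set.mem_image_of_mem f x.2⟩,
    (f.continuous.comp continuous_subtype_val).subtype_mk _⟩

theorem restr_mapsTo (f : C(X, Y)) (hf : Set.MapsTo f X₀ Y₀) (a : CompactSubpair X X₀) :
    Set.MapsTo (restr f hf a) a.sub (a.map f hf).sub :=
  fun _ hx => Set.mem_image_of_mem f hx

end CompactSubpair

open CompactSubpair

/-- The `n`-th CH-shape cohomology group `Ĥⁿ(X, X₀; G)`: the inverse limit of the groups
`Hⁿ(K, K₀; G)` over the compact subpairs `(K, K₀)` of `(X, X₀)`, with the homomorphisms induced by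
inclusions as bonding maps, realised as the group of compatible families. -/
def cohomology (X : Type u) [TopologicalSpace X] (X₀ : Set X) (G : Type w) [AddCommGroup G]
    (n : ℕ) : AddSubgroup (∀ a : CompactSubpair X X₀, Cohomology a.K a.sub G n) where
  carrier := {x | ∀ (a b : CompactSubpair X X₀) (h : a ≤ b),
    cohomologyMap (incl h) (incl_mapsTo h) G n (x b) = x a}
  zero_mem' := fun _ _ _ => map_zero _
  add_mem' := fun {x y} hx hy a b h => by
    rw [Pi.add_apply, Pi.add_apply, map_add, hx a b h, hy a b h]
  neg_mem' := fun {x} hx a b h => by rw [Pi.neg_apply, Pi.neg_apply, map_neg, hx a b h]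

/-- The homomorphism `f̂ⁿ : Ĥⁿ(Y, Y₀; G) → Ĥⁿ(X, X₀; G)` induced by a continuous map of pairs
`f : (X, X₀) → (Y, Y₀)`: its component at `(K, K₀)` is the component at `(f(K), f(K₀))` pulled back
along `f : (K, K₀) → (f(K), f(K₀))`. -/
def map {X : Type u} {Y : Type v} [TopologicalSpace X] [TopologicalSpace Y]
    {X₀ : Set X} {Y₀ : Set Y} (f : C(X, Y)) (hf : Set.MapsTo f X₀ Y₀)
    (G : Type w) [AddCommGroup G] (n : ℕ) :
    cohomology Y Y₀ G n →+ cohomology X X₀ G n where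
  toFun y := ⟨fun a => cohomologyMap (restr f hf a) (restr_mapsTo f hf a) G n (y.1 (a.map f hf)),
    fun a b h => by
      dsimp only
      rw [← y.2 _ _ (map_mono f hf h),
        ← cohomologyMap_comp, ← cohomologyMap_comp]
      rfl⟩
  map_zero' := Subtype.ext (funext fun _ => map_zero _)
  map_add' _ _ := Subtype.ext (funext fun _ => map_add _ _ _)

/-- The inclusion `X ∖ W → X`. -/
def complInclusion {X : Type u} [TopologicalSpace X] (W : Set X) :
    C((Wᶜ : Set X), X) :=
  ⟨Subtype.val, continuous_subtype_val⟩

/-- The inclusion is a map of pairs `(X ∖ W, X₀ ∖ W) → (X, X₀)`. -/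
theorem complInclusion_mapsTo {X : Type u} [TopologicalSpace X] (W X₀ : Set X) :
    Set.MapsTo (complInclusion W) (Subtype.val ⁻¹' (X₀ \ W)) X₀ :=
  fun _ hx => hx.1

end CHShape

end

noncomputable section

namespace Singular

universe u v w

/-! ## Ordered tuples of points -/

/-! Singular excision does not apply to every compact subpair `(K, K₀)`: the trace of `closure W` on
`K` need not lie in the interior of `K₀` relative to `K`. But `K` is compact Hausdorff, hence
normal, so some `V` open in `K` satisfies `K ∩ closure W ⊆ V` and `closure V ⊆ interior X₀`.
Replacing `K₀` by `K₀ ∪ closure V` gives a larger compact subpair to which excision does apply. Such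
adapted subpairs are therefore cofinal (`exists_isAdapted_ge`), the subpairs `(K ∖ W, K₀ ∖ W)` are
cofinal for `X ∖ W`, and the excision isomorphisms at adapted subpairs commute with restriction, so
they pass to the inverse limit.

Singular excision (`cohomologyMap_bijective_of_isEmbedding`) rests on small chains. Subdivision and
its homotopy are built on formal tuples of points, where every identity follows from the cone
formula, and are carried to singular chains by `realize`. Iterating a number of times that depends
on the simplex gives a chain map `ρ` onto small chains, homotopic to the identity by `D`
(`exists_smallChains_chainMap`). A cochain on the subspace is then extended by zero and precomposed
with `ρ`; this gives explicit preimages and primitives. -/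

/-- Integral chains on the `k`-tuples of elements of `V`. With the boundary `tupleBoundary` they
form an augmented chain complex, the empty tuple spanning the augmentation. -/
abbrev TupleChain (V : Type u) (k : ℕ) : Type u := (Fin k → V) →₀ ℤ

/-- The alternating sum of the tuples with one entry omitted. -/
def tupleBoundary (V : Type u) (k : ℕ) : TupleChain V (k + 1) →ₗ[ℤ] TupleChain V k :=
  ∑ i : Fin (k + 1), (-1 : ℤ) ^ (i : ℕ) • Finsupp.lmapDomain ℤ ℤ (fun w => w ∘ i.succAbove)

/-- The cone operator, which prepends `b` to a tuple. -/
def tupleCone {V : Type u} (b : V) (k : ℕ) : TupleChain V k →ₗ[ℤ] TupleChain V (k + 1) :=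
  Finsupp.lmapDomain ℤ ℤ (fun w => (Fin.cons b w : Fin (k + 1) → V))

/-- The map of tuple chains induced by a map of points. -/
def tupleMap {V : Type u} {V' : Type v} (f : V → V') (k : ℕ) :
    TupleChain V k →ₗ[ℤ] TupleChain V' k :=
  Finsupp.lmapDomain ℤ ℤ (fun w => f ∘ w)

section tuples

variable {V : Type u} {V' : Type v}

theorem tuple_hom_ext {M : Type*} [AddCommGroup M] {k : ℕ} {φ ψ : TupleChain V k →ₗ[ℤ] M}
    (h : ∀ w, φ (Finsupp.single w 1) = ψ (Finsupp.single w 1)) : φ = ψ := by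
  refine Finsupp.lhom_ext' fun w => LinearMap.ext_ring ?_
  simpa using h w

theorem tupleBoundary_single (k : ℕ) (w : Fin (k + 1) → V) :
    tupleBoundary V k (Finsupp.single w 1) =
      ∑ i : Fin (k + 1), (-1 : ℤ) ^ (i : ℕ) • Finsupp.single (w ∘ i.succAbove) (1 : ℤ) := by
  simp [tupleBoundary, LinearMap.sum_apply]

theorem tupleCone_single (b : V) (k : ℕ) (w : Fin k → V) :
    tupleCone b k (Finsupp.single w 1) = Finsupp.single (Fin.cons b w) 1 := by
  simp [tupleCone]

theorem tupleMap_single (f : V → V') (k : ℕ) (w : Fin k → V) :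
    tupleMap f k (Finsupp.single w 1) = Finsupp.single (f ∘ w) 1 := by
  simp [tupleMap]

theorem cons_comp_succAbove_succ (b : V) {k : ℕ} (w : Fin (k + 1) → V) (i : Fin (k + 1)) :
    (Fin.cons b w : Fin (k + 2) → V) ∘ i.succ.succAbove = Fin.cons b (w ∘ i.succAbove) := by
  funext j
  refine Fin.cases ?_ (fun j => ?_) j <;> simp

theorem tupleBoundary_tupleCone_zero (b : V) (c : TupleChain V 0) :
    tupleBoundary V 0 (tupleCone b 0 c) = c := by
  refine LinearMap.congr_fun (f := tupleBoundary V 0 ∘ₗ tupleCone b 0) (g := LinearMap.id)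
    (tuple_hom_ext fun w => ?_) c
  simp only [LinearMap.comp_apply, tupleCone_single, tupleBoundary_single, LinearMap.id_apply]
  simp [Subsingleton.elim _ w]

/-- Omitting the apex returns the tuple; omitting entry `i` of the tuple omits entry `i + 1` of the
cone, whence the minus sign. The formulas for `∂∂`, subdivision and its homotopy all come from this
one. -/
theorem tupleBoundary_tupleCone (b : V) (k : ℕ) (c : TupleChain V (k + 1)) :
    tupleBoundary V (k + 1) (tupleCone b (k + 1) c) = c - tupleCone b k (tupleBoundary V k c) := by
  refine LinearMap.congr_fun (f := tupleBoundary V (k + 1) ∘ₗ tupleCone b (k + 1))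
    (g := LinearMap.id - tupleCone b k ∘ₗ tupleBoundary V k) (tuple_hom_ext fun w => ?_) c
  simp only [LinearMap.comp_apply, LinearMap.sub_apply, LinearMap.id_apply, tupleCone_single,
    tupleBoundary_single, map_sum, map_zsmul]
  rw [Fin.sum_univ_succ, sub_eq_add_neg, ← Finset.sum_neg_distrib]
  congr 1
  · simp only [Fin.val_zero, pow_zero, one_smul]
    congr 1
  · refine Finset.sum_congr rfl fun i _ => ?_
    rw [cons_comp_succAbove_succ, Fin.val_succ, pow_succ, mul_neg_one, neg_smul]

/-- A nonempty tuple is the cone from its first entry over its tail, so the cone formula reduces the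
claim to shorter tuples. -/
theorem tupleBoundary_tupleBoundary (k : ℕ) (c : TupleChain V (k + 2)) :
    tupleBoundary V k (tupleBoundary V (k + 1) c) = 0 := by
  refine LinearMap.congr_fun (f := tupleBoundary V k ∘ₗ tupleBoundary V (k + 1))
    (g := 0) (tuple_hom_ext fun w => ?_) c
  rw [LinearMap.comp_apply, LinearMap.zero_apply, ← Fin.cons_self_tail w, ← tupleCone_single,
    tupleBoundary_tupleCone, map_sub]
  cases k with
  | zero => rw [tupleBoundary_tupleCone_zero, sub_self]
  | succ k =>
    rw [tupleBoundary_tupleCone, tupleBoundary_tupleBoundary k, map_zero, sub_zero, sub_self]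

theorem tupleMap_tupleBoundary (f : V → V') (k : ℕ) (c : TupleChain V (k + 1)) :
    tupleMap f k (tupleBoundary V k c) = tupleBoundary V' k (tupleMap f (k + 1) c) := by
  refine LinearMap.congr_fun (f := tupleMap f k ∘ₗ tupleBoundary V k)
    (g := tupleBoundary V' k ∘ₗ tupleMap f (k + 1)) (tuple_hom_ext fun w => ?_) c
  simp only [LinearMap.comp_apply, tupleMap_single, tupleBoundary_single, map_sum, map_zsmul,
    Function.comp_assoc]

theorem tupleMap_tupleCone (f : V → V') (b : V) (k : ℕ) (c : TupleChain V k) :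
    tupleMap f (k + 1) (tupleCone b k c) = tupleCone (f b) k (tupleMap f k c) := by
  refine LinearMap.congr_fun (f := tupleMap f (k + 1) ∘ₗ tupleCone b k)
    (g := tupleCone (f b) k ∘ₗ tupleMap f k) (tuple_hom_ext fun w => ?_) c
  simp only [LinearMap.comp_apply, tupleMap_single, tupleCone_single]
  congr 1
  funext j
  refine Fin.cases ?_ (fun j => ?_) j <;> simp

/-! ## Subdivision of tuples -/

/-- Subdivision of tuple chains with respect to a choice `β` of a centre for every tuple. -/
def tupleSubdiv (β : ∀ k, (Fin (k + 1) → V) → V) : ∀ k, TupleChain V k →ₗ[ℤ] TupleChain V k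
  | 0 => LinearMap.id
  | k + 1 => Finsupp.linearCombination ℤ fun w =>
      tupleCone (β k w) k (tupleSubdiv β k (tupleBoundary V k (Finsupp.single w 1)))

/-- The chain homotopy from the identity to `tupleSubdiv`. -/
def tupleHomotopy (β : ∀ k, (Fin (k + 1) → V) → V) :
    ∀ k, TupleChain V k →ₗ[ℤ] TupleChain V (k + 1)
  | 0 => 0
  | k + 1 => Finsupp.linearCombination ℤ fun w =>
      tupleCone (β k w) (k + 1)
        (Finsupp.single w 1 - tupleHomotopy β k (tupleBoundary V k (Finsupp.single w 1)))

variable (β : ∀ k, (Fin (k + 1) → V) → V) (β' : ∀ k, (Fin (k + 1) → V') → V')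

theorem tupleSubdiv_single (k : ℕ) (w : Fin (k + 1) → V) :
    tupleSubdiv β (k + 1) (Finsupp.single w 1) =
      tupleCone (β k w) k (tupleSubdiv β k (tupleBoundary V k (Finsupp.single w 1))) := by
  simp [tupleSubdiv]

theorem tupleHomotopy_single (k : ℕ) (w : Fin (k + 1) → V) :
    tupleHomotopy β (k + 1) (Finsupp.single w 1) =
      tupleCone (β k w) (k + 1)
        (Finsupp.single w 1 - tupleHomotopy β k (tupleBoundary V k (Finsupp.single w 1))) := by
  simp [tupleHomotopy]

/-- With `S` the subdivision, `S w` is a cone over `S ∂w`, which inductively is a cycle because `∂∂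
= 0`; the boundary of a cone over a cycle is that cycle. -/
theorem tupleBoundary_tupleSubdiv (k : ℕ) (c : TupleChain V (k + 1)) :
    tupleBoundary V k (tupleSubdiv β (k + 1) c) = tupleSubdiv β k (tupleBoundary V k c) := by
  refine LinearMap.congr_fun (f := tupleBoundary V k ∘ₗ tupleSubdiv β (k + 1))
    (g := tupleSubdiv β k ∘ₗ tupleBoundary V k) (tuple_hom_ext fun w => ?_) c
  rw [LinearMap.comp_apply, tupleSubdiv_single, LinearMap.comp_apply]
  cases k with
  | zero => rw [tupleBoundary_tupleCone_zero]
  | succ k =>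
    rw [tupleBoundary_tupleCone, tupleBoundary_tupleSubdiv k, tupleBoundary_tupleBoundary,
      map_zero, map_zero, sub_zero]

theorem tupleBoundary_tupleHomotopy_zero (c : TupleChain V 1) :
    tupleBoundary V 1 (tupleHomotopy β 1 c) = c - tupleSubdiv β 1 c := by
  refine LinearMap.congr_fun (f := tupleBoundary V 1 ∘ₗ tupleHomotopy β 1)
    (g := LinearMap.id - tupleSubdiv β 1) (tuple_hom_ext fun w => ?_) c
  simp [tupleHomotopy, tupleBoundary_tupleCone, tupleSubdiv]

theorem tupleBoundary_tupleHomotopy (k : ℕ) (c : TupleChain V (k + 1)) :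
    tupleBoundary V (k + 1) (tupleHomotopy β (k + 1) c) +
      tupleHomotopy β k (tupleBoundary V k c) = c - tupleSubdiv β (k + 1) c := by
  refine LinearMap.congr_fun (f := tupleBoundary V (k + 1) ∘ₗ tupleHomotopy β (k + 1) +
      tupleHomotopy β k ∘ₗ tupleBoundary V k)
    (g := LinearMap.id - tupleSubdiv β (k + 1)) (tuple_hom_ext fun w => ?_) c
  simp only [LinearMap.add_apply, LinearMap.sub_apply, LinearMap.comp_apply, LinearMap.id_apply]
  cases k with
  | zero => rw [tupleBoundary_tupleHomotopy_zero]; simp [tupleHomotopy]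
  | succ k =>
    -- With `T` the homotopy, induction gives `∂T∂w = ∂w - S∂w`, so `w - T∂w` has boundary `S∂w`,
    -- and the cone over `S∂w` is `S w`.
    have h := tupleBoundary_tupleHomotopy k (tupleBoundary V (k + 1) (Finsupp.single w 1))
    rw [tupleBoundary_tupleBoundary, map_zero, add_zero] at h
    rw [tupleHomotopy_single, tupleBoundary_tupleCone, map_sub, h, tupleSubdiv_single]
    simp only [sub_sub_cancel]
    abel

/-- Naturality only needs `f` to respect the chosen centres. It is applied to affine maps, which
carry barycentres to barycentres. -/
theorem tupleMap_tupleSubdiv (f : V → V') (hf : ∀ k w, f (β k w) = β' k (f ∘ w)) (k : ℕ)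
    (c : TupleChain V k) :
    tupleMap f k (tupleSubdiv β k c) = tupleSubdiv β' k (tupleMap f k c) := by
  cases k with
  | zero => rfl
  | succ k =>
    refine LinearMap.congr_fun (f := tupleMap f (k + 1) ∘ₗ tupleSubdiv β (k + 1))
      (g := tupleSubdiv β' (k + 1) ∘ₗ tupleMap f (k + 1)) (tuple_hom_ext fun w => ?_) c
    simp only [LinearMap.comp_apply]
    rw [tupleSubdiv_single, tupleMap_tupleCone, tupleMap_tupleSubdiv f hf k,
      tupleMap_tupleBoundary, tupleMap_single, tupleSubdiv_single, hf]

theorem tupleMap_tupleHomotopy (f : V → V') (hf : ∀ k w, f (β k w) = β' k (f ∘ w)) (k : ℕ)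
    (c : TupleChain V k) :
    tupleMap f (k + 1) (tupleHomotopy β k c) = tupleHomotopy β' k (tupleMap f k c) := by
  cases k with
  | zero => simp [tupleHomotopy]
  | succ k =>
    refine LinearMap.congr_fun (f := tupleMap f (k + 2) ∘ₗ tupleHomotopy β (k + 1))
      (g := tupleHomotopy β' (k + 1) ∘ₗ tupleMap f (k + 1)) (tuple_hom_ext fun w => ?_) c
    simp only [LinearMap.comp_apply]
    rw [tupleHomotopy_single, tupleMap_tupleCone, map_sub, tupleMap_tupleHomotopy f hf k,
      tupleMap_tupleBoundary, tupleMap_single, tupleHomotopy_single, hf]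

end tuples

/-- A linear map on finitely supported functions sends `supported s` into a submodule as soon as it
does so for the generators. -/
theorem map_mem_of_mem_supported {α M : Type*} [AddCommGroup M] {s : Set α} {N : Submodule ℤ M}
    (φ : (α →₀ ℤ) →ₗ[ℤ] M) (h : ∀ a ∈ s, φ (Finsupp.single a 1) ∈ N) {c : α →₀ ℤ}
    (hc : c ∈ Finsupp.supported ℤ ℤ s) : φ c ∈ N := by
  rw [Finsupp.supported_eq_span_single] at hc
  refine (Submodule.span_le (p := N.comap φ)).2 ?_ hc
  rintro _ ⟨a, ha, rfl⟩
  exact h a ha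

/-! ## Affine simplices and the mesh of a subdivision -/

/-- The affine map `Δᵏ → Δⁿ` with prescribed values on the vertices. -/
def affineSimplex {k n : ℕ} (w : Fin (k + 1) → Simplex n) : C(Simplex k, Simplex n) where
  toFun t := ⟨fun j => ∑ i, t i * w i j, fun j =>
    Finset.sum_nonneg fun i _ => mul_nonneg (stdSimplex.zero_le t i) (stdSimplex.zero_le (w i) j), by
      rw [Finset.sum_comm]
      simp [← Finset.mul_sum]⟩
  continuous_toFun := by
    refine Continuous.subtype_mk (continuous_pi fun j => continuous_finsetSum _ fun i _ => ?_) _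
    exact ((continuous_apply i).comp continuous_subtype_val).mul continuous_const

/-- The vertices of the standard simplex. -/
def vertices (n : ℕ) : Fin (n + 1) → Simplex n := fun i => stdSimplex.vertex i

/-- The barycentre of the affine simplex with vertices `w`. -/
def barycentre (n k : ℕ) (w : Fin (k + 1) → Simplex n) : Simplex n :=
  affineSimplex w stdSimplex.barycenter

section affine

variable {k l n : ℕ}

theorem affineSimplex_apply (w : Fin (k + 1) → Simplex n) (t : Simplex k) (j : Fin (n + 1)) :
    affineSimplex w t j = ∑ i, t i * w i j := rfl

theorem affineSimplex_vertices (n : ℕ) :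
    affineSimplex (vertices n) = ContinuousMap.id (Simplex n) := by
  ext t j
  simp [affineSimplex_apply, vertices, Pi.single_apply]

theorem affineSimplex_comp_vertices (w : Fin (k + 1) → Simplex n) :
    affineSimplex w ∘ vertices k = w := by
  funext i
  ext j
  simp [affineSimplex_apply, vertices, Pi.single_apply]

theorem affineSimplex_comp (w : Fin (k + 1) → Simplex n) (u : Fin (l + 1) → Simplex k) :
    (affineSimplex w).comp (affineSimplex u) = affineSimplex (affineSimplex w ∘ u) := by
  ext t j
  simp only [ContinuousMap.comp_apply, affineSimplex_apply, Function.comp_apply, Finset.sum_mul,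
    Finset.mul_sum]
  rw [Finset.sum_comm]
  simp only [mul_assoc]

theorem faceInclusion_eq (n : ℕ) (i : Fin (n + 2)) :
    faceInclusion n i = affineSimplex (vertices (n + 1) ∘ i.succAbove) := by
  ext t j
  simp only [faceInclusion, ContinuousMap.coe_mk, stdSimplex.map_coe,
    FunOnFinite.linearMap_apply_apply, affineSimplex_apply, vertices, Function.comp_apply,
    stdSimplex.vertex_coe, Pi.single_apply, mul_ite, mul_one, mul_zero, Finset.sum_filter]
  exact Finset.sum_congr rfl fun x _ => by simp only [eq_comm]

theorem affineSimplex_comp_faceInclusion (w : Fin (k + 2) → Simplex n) (i : Fin (k + 2)) :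
    (affineSimplex w).comp (faceInclusion k i) = affineSimplex (w ∘ i.succAbove) := by
  rw [faceInclusion_eq, affineSimplex_comp, ← Function.comp_assoc, affineSimplex_comp_vertices]

theorem affineSimplex_barycentre (w : Fin (k + 1) → Simplex n) (l : ℕ)
    (u : Fin (l + 1) → Simplex k) :
    affineSimplex w (barycentre k l u) = barycentre n l (affineSimplex w ∘ u) := by
  rw [barycentre, barycentre, ← affineSimplex_comp, ContinuousMap.comp_apply]

/-! ### Distance estimates in affine simplices -/

theorem dist_affineSimplex_le (w : Fin (k + 1) → Simplex n) (t : Simplex k) (x : Simplex n) :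
    dist (affineSimplex w t) x ≤ ∑ i, t i * dist (w i) x := by
  have hnn : ∀ i, 0 ≤ t i * dist (w i) x := fun i => mul_nonneg (stdSimplex.zero_le t i) dist_nonneg
  rw [Subtype.dist_eq, dist_pi_le_iff (Finset.sum_nonneg fun i _ => hnn i)]
  intro j
  have h : (affineSimplex w t).1 j - x.1 j = ∑ i, t i * ((w i).1 j - x.1 j) := by
    simp only [mul_sub, Finset.sum_sub_distrib, ← Finset.sum_mul, stdSimplex.sum_eq_one, one_mul]
    rfl
  rw [Real.dist_eq, h]
  refine (Finset.abs_sum_le_sum_abs _ _).trans (Finset.sum_le_sum fun i _ => ?_)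
  rw [abs_mul, abs_of_nonneg (stdSimplex.zero_le t i), ← Real.dist_eq]
  exact mul_le_mul_of_nonneg_left (dist_le_pi_dist (w i).1 x.1 j) (stdSimplex.zero_le t i)

theorem affineSimplex_mem_closedBall {w : Fin (k + 1) → Simplex n} {x : Simplex n} {r : ℝ}
    (hw : ∀ i, w i ∈ Metric.closedBall x r) (t : Simplex k) :
    affineSimplex w t ∈ Metric.closedBall x r := by
  refine (dist_affineSimplex_le w t x).trans ?_
  calc ∑ i, t i * dist (w i) x ≤ ∑ i, t i * r :=
        Finset.sum_le_sum fun i _ => mul_le_mul_of_nonneg_left (hw i) (stdSimplex.zero_le t i)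
    _ = r := by rw [← Finset.sum_mul, stdSimplex.sum_eq_one, one_mul]

/-- The distance is at most the mean of the distances from `w i` to the `k + 1` vertices. The one to
`w i` itself is zero, leaving `k` terms of weight `1 / (k + 1)`. -/
theorem dist_barycentre_le {w : Fin (k + 1) → Simplex n} {d : ℝ}
    (hw : ∀ i j, dist (w i) (w j) ≤ d) (i : Fin (k + 1)) :
    dist (barycentre n k w) (w i) ≤ k / (k + 1) * d := by
  refine (dist_affineSimplex_le w _ (w i)).trans ?_
  have hb : ∀ l : Fin (k + 1), (stdSimplex.barycenter : Simplex k) l = ((k : ℝ) + 1)⁻¹ := by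
    intro l
    change ((Fintype.card (Fin (k + 1)) : ℕ) : ℝ)⁻¹ = _
    simp
  simp only [hb]
  rw [← Finset.mul_sum, Fin.sum_univ_succAbove _ i, dist_self, zero_add, div_eq_inv_mul, mul_assoc]
  refine mul_le_mul_of_nonneg_left ?_ (by positivity)
  refine (Finset.sum_le_sum fun j _ => hw (i.succAbove j) i).trans ?_
  simp

/-- The subdivision of a chain of tuples lying in a ball of `Δⁿ` again lies in that ball. -/
theorem tupleSubdiv_mem_closedBall {x : Simplex n} {r : ℝ} (k : ℕ) {c : TupleChain (Simplex n) k}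
    (hc : c ∈ Finsupp.supported ℤ ℤ {w | ∀ i, w i ∈ Metric.closedBall x r}) :
    tupleSubdiv (barycentre n) k c ∈
      Finsupp.supported ℤ ℤ {w | ∀ i, w i ∈ Metric.closedBall x r} := by
  induction k with
  | zero => exact hc
  | succ k ih =>
    refine map_mem_of_mem_supported _ (fun w hw => ?_) hc
    rw [tupleSubdiv_single]
    refine map_mem_of_mem_supported _ (fun u hu => ?_) (ih ?_)
    · rw [tupleCone_single]
      refine Finsupp.single_mem_supported ℤ _ fun i => ?_
      refine Fin.cases ?_ (fun j => ?_) i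
      · exact affineSimplex_mem_closedBall hw _
      · exact hu j
    · rw [tupleBoundary_single]
      exact Submodule.sum_mem _ fun i _ => Submodule.smul_mem _ _
        (Finsupp.single_mem_supported ℤ _ fun j => hw _)

/-- Barycentric subdivision multiplies the mesh of a chain of `k`-simplices by at most
`k / (k + 1)`. -/
theorem tupleSubdiv_mesh (k : ℕ) {d : ℝ} (hd : 0 ≤ d) {c : TupleChain (Simplex n) (k + 1)}
    (hc : c ∈ Finsupp.supported ℤ ℤ {w | ∀ i j, dist (w i) (w j) ≤ d}) :
    tupleSubdiv (barycentre n) (k + 1) c ∈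
      Finsupp.supported ℤ ℤ {w | ∀ i j, dist (w i) (w j) ≤ k / (k + 1) * d} := by
  refine map_mem_of_mem_supported _ (fun w hw => ?_) hc
  have hd' : 0 ≤ (k : ℝ) / (k + 1) * d := by positivity
  rw [tupleSubdiv_single]
  -- `hball` bounds the edges issuing from the new apex; `hmesh` below bounds those of the opposite
  -- face, by induction and `k / (k + 1) ≤ (k + 1) / (k + 2)`.
  have hball : tupleSubdiv (barycentre n) k
      (tupleBoundary (Simplex n) k (Finsupp.single w 1)) ∈ Finsupp.supported ℤ ℤ
        {u | ∀ i, u i ∈ Metric.closedBall (barycentre n k w) (k / (k + 1) * d)} := by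
    refine tupleSubdiv_mem_closedBall k ?_
    rw [tupleBoundary_single]
    refine Submodule.sum_mem _ fun i _ => Submodule.smul_mem _ _
      (Finsupp.single_mem_supported ℤ _ fun j => ?_)
    rw [Metric.mem_closedBall, dist_comm]
    exact dist_barycentre_le hw _
  have hmesh : tupleSubdiv (barycentre n) k
      (tupleBoundary (Simplex n) k (Finsupp.single w 1)) ∈ Finsupp.supported ℤ ℤ
        {u | ∀ i j, dist (u i) (u j) ≤ k / (k + 1) * d} := by
    cases k with
    | zero =>
      refine (Finsupp.mem_supported ℤ _).2 fun u _ i => i.elim0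
    | succ k =>
      refine Finsupp.supported_mono ?_ (tupleSubdiv_mesh k hd ?_)
      · intro u hu i j
        refine (hu i j).trans (mul_le_mul_of_nonneg_right ?_ hd)
        rw [div_le_div_iff₀ (by positivity) (by positivity)]
        push_cast
        nlinarith
      · rw [tupleBoundary_single]
        exact Submodule.sum_mem _ fun i _ => Submodule.smul_mem _ _
          (Finsupp.single_mem_supported ℤ _ fun j l => hw _ _)
  have hboth := (Finsupp.supported_inter (M := ℤ) (R := ℤ) _ _).ge ⟨hball, hmesh⟩
  refine map_mem_of_mem_supported _ (fun u hu => ?_) hboth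
  rw [tupleCone_single]
  refine Finsupp.single_mem_supported ℤ _ fun i j => ?_
  refine Fin.cases (Fin.cases ?_ (fun j => ?_) j) (fun i => Fin.cases ?_ (fun j => ?_) j) i
  · simpa using hd'
  · simpa [dist_comm] using hu.1 j
  · simpa using hu.1 i
  · simpa using hu.2 i j

theorem tupleSubdiv_pow_mesh (k m : ℕ) {d : ℝ} (hd : 0 ≤ d)
    {c : TupleChain (Simplex n) (k + 1)}
    (hc : c ∈ Finsupp.supported ℤ ℤ {w | ∀ i j, dist (w i) (w j) ≤ d}) :
    (tupleSubdiv (barycentre n) (k + 1) ^ m) c ∈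
      Finsupp.supported ℤ ℤ {w | ∀ i j, dist (w i) (w j) ≤ ((k : ℝ) / (k + 1)) ^ m * d} := by
  induction m with
  | zero => simpa using hc
  | succ m ih =>
    rw [pow_succ' (tupleSubdiv _ _), Module.End.mul_apply]
    simp only [pow_succ', mul_assoc]
    exact tupleSubdiv_mesh k (by positivity) ih

/-- Sufficiently fine iterated barycentric subdivisions of `Δⁿ` consist of simplices of arbitrarily small
diameter. -/
theorem exists_tupleSubdiv_pow_mesh (n : ℕ) {δ : ℝ} (hδ : 0 < δ) :
    ∃ m, (tupleSubdiv (barycentre n) (n + 1) ^ m) (Finsupp.single (vertices n) 1) ∈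
        Finsupp.supported ℤ ℤ {w | ∀ i j, dist (w i) (w j) < δ} := by
  obtain ⟨d, hd⟩ := (Metric.isBounded_iff_exists_ge 0).1
    (Metric.isBounded_of_compactSpace (s := (Set.univ : Set (Simplex n))))
  have hlim := (tendsto_pow_atTop_nhds_zero_of_lt_one (r := (n : ℝ) / (n + 1)) (by positivity)
    (by rw [div_lt_one (by positivity)]; linarith)).mul_const d
  rw [zero_mul] at hlim
  obtain ⟨m, hm⟩ := (hlim.eventually (gt_mem_nhds hδ)).exists
  refine ⟨m, Finsupp.supported_mono (fun w hw i j => (hw i j).trans_lt hm)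
    (tupleSubdiv_pow_mesh n m hd.1 ?_)⟩
  exact Finsupp.single_mem_supported ℤ _ fun i j => hd.2 trivial trivial

end affine

/-! ## Subdivision of singular chains -/

section subdivision

variable {X : Type u} [TopologicalSpace X]

/-- The chain map sending a tuple of points of `Δⁿ` to the composite of `σ : Δⁿ → X` with the affine
simplex spanned by the tuple. -/
def realize {n : ℕ} (σ : C(Simplex n, X)) (k : ℕ) :
    TupleChain (Simplex n) (k + 1) →ₗ[ℤ] Chain X k :=
  Finsupp.lmapDomain ℤ ℤ (fun w => σ.comp (affineSimplex w))

theorem realize_single {n : ℕ} (σ : C(Simplex n, X)) (k : ℕ) (w : Fin (k + 1) → Simplex n) :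
    realize σ k (Finsupp.single w 1) = Finsupp.single (σ.comp (affineSimplex w)) 1 := by
  simp [realize]

theorem realize_vertices {n : ℕ} (σ : C(Simplex n, X)) :
    realize σ n (Finsupp.single (vertices n) 1) = Finsupp.single σ 1 := by
  rw [realize_single, affineSimplex_vertices, ContinuousMap.comp_id]

theorem boundary_realize {n : ℕ} (σ : C(Simplex n, X)) (k : ℕ)
    (c : TupleChain (Simplex n) (k + 2)) :
    boundary X k (realize σ (k + 1) c) = realize σ k (tupleBoundary _ (k + 1) c) := by
  refine LinearMap.congr_fun (f := boundary X k ∘ₗ realize σ (k + 1))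
    (g := realize σ k ∘ₗ tupleBoundary _ (k + 1)) (tuple_hom_ext fun w => ?_) c
  simp only [LinearMap.comp_apply, realize_single, boundary_single, tupleBoundary_single, map_sum,
    map_zsmul, ContinuousMap.comp_assoc, affineSimplex_comp_faceInclusion]

theorem realize_comp_affineSimplex {n l : ℕ} (σ : C(Simplex n, X)) (w : Fin (l + 1) → Simplex n)
    (k : ℕ) (c : TupleChain (Simplex l) (k + 1)) :
    realize (σ.comp (affineSimplex w)) k c = realize σ k (tupleMap (affineSimplex w) (k + 1) c) := by
  refine LinearMap.congr_fun (f := realize (σ.comp (affineSimplex w)) k)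
    (g := realize σ k ∘ₗ tupleMap (affineSimplex w) (k + 1)) (tuple_hom_ext fun u => ?_) c
  simp only [LinearMap.comp_apply, realize_single, tupleMap_single, ContinuousMap.comp_assoc,
    affineSimplex_comp]

variable (X) in
/-- Barycentric subdivision of singular chains. -/
def subdiv (n : ℕ) : Chain X n →ₗ[ℤ] Chain X n :=
  Finsupp.linearCombination ℤ fun σ =>
    realize σ n (tupleSubdiv (barycentre n) (n + 1) (Finsupp.single (vertices n) 1))

variable (X) in
/-- The chain homotopy from the identity to barycentric subdivision. -/
def subdivHomotopy (n : ℕ) : Chain X n →ₗ[ℤ] Chain X (n + 1) :=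
  Finsupp.linearCombination ℤ fun σ =>
    realize σ (n + 1) (tupleHomotopy (barycentre n) (n + 1) (Finsupp.single (vertices n) 1))

theorem subdiv_single {n : ℕ} (σ : C(Simplex n, X)) :
    subdiv X n (Finsupp.single σ 1) =
      realize σ n (tupleSubdiv (barycentre n) (n + 1) (Finsupp.single (vertices n) 1)) := by
  simp [subdiv]

theorem subdivHomotopy_single {n : ℕ} (σ : C(Simplex n, X)) :
    subdivHomotopy X n (Finsupp.single σ 1) =
      realize σ (n + 1) (tupleHomotopy (barycentre n) (n + 1) (Finsupp.single (vertices n) 1)) := by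
  simp [subdivHomotopy]

/-- Subdividing `σ ∘ w` for an affine `w` can be done inside `Δⁿ`, by naturality. As every `σ` is
the realization of the tuple of vertices, identities for tuples transfer to singular chains. -/
theorem subdiv_realize {n : ℕ} (σ : C(Simplex n, X)) (k : ℕ)
    (c : TupleChain (Simplex n) (k + 1)) :
    subdiv X k (realize σ k c) = realize σ k (tupleSubdiv (barycentre n) (k + 1) c) := by
  refine LinearMap.congr_fun (f := subdiv X k ∘ₗ realize σ k)
    (g := realize σ k ∘ₗ tupleSubdiv (barycentre n) (k + 1)) (tuple_hom_ext fun w => ?_) c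
  rw [LinearMap.comp_apply, LinearMap.comp_apply, realize_single, subdiv_single,
    realize_comp_affineSimplex,
    tupleMap_tupleSubdiv _ (barycentre n) _ (affineSimplex_barycentre w), tupleMap_single,
    affineSimplex_comp_vertices]

theorem subdivHomotopy_realize {n : ℕ} (σ : C(Simplex n, X)) (k : ℕ)
    (c : TupleChain (Simplex n) (k + 1)) :
    subdivHomotopy X k (realize σ k c) =
      realize σ (k + 1) (tupleHomotopy (barycentre n) (k + 1) c) := by
  refine LinearMap.congr_fun (f := subdivHomotopy X k ∘ₗ realize σ k)
    (g := realize σ (k + 1) ∘ₗ tupleHomotopy (barycentre n) (k + 1)) (tuple_hom_ext fun w => ?_) c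
  rw [LinearMap.comp_apply, LinearMap.comp_apply, realize_single, subdivHomotopy_single,
    realize_comp_affineSimplex,
    tupleMap_tupleHomotopy _ (barycentre n) _ (affineSimplex_barycentre w), tupleMap_single,
    affineSimplex_comp_vertices]

theorem subdiv_pow_realize {n : ℕ} (σ : C(Simplex n, X)) (k m : ℕ)
    (c : TupleChain (Simplex n) (k + 1)) :
    (subdiv X k ^ m) (realize σ k c) = realize σ k ((tupleSubdiv (barycentre n) (k + 1) ^ m) c) := by
  induction m with
  | zero => rfl
  | succ m ih => rw [pow_succ', Module.End.mul_apply, ih, subdiv_realize, pow_succ',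
      Module.End.mul_apply]

theorem boundary_subdiv (n : ℕ) (c : Chain X (n + 1)) :
    boundary X n (subdiv X (n + 1) c) = subdiv X n (boundary X n c) := by
  refine LinearMap.congr_fun (f := boundary X n ∘ₗ subdiv X (n + 1))
    (g := subdiv X n ∘ₗ boundary X n) (chain_hom_ext fun σ => ?_) c
  rw [LinearMap.comp_apply, LinearMap.comp_apply, ← realize_vertices, subdiv_realize,
    boundary_realize, boundary_realize, subdiv_realize, tupleBoundary_tupleSubdiv]

theorem boundary_subdivHomotopy (n : ℕ) (c : Chain X (n + 1)) :
    boundary X (n + 1) (subdivHomotopy X (n + 1) c) + subdivHomotopy X n (boundary X n c) =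
      c - subdiv X (n + 1) c := by
  refine LinearMap.congr_fun
    (f := boundary X (n + 1) ∘ₗ subdivHomotopy X (n + 1) + subdivHomotopy X n ∘ₗ boundary X n)
    (g := LinearMap.id - subdiv X (n + 1)) (chain_hom_ext fun σ => ?_) c
  simp only [LinearMap.add_apply, LinearMap.sub_apply, LinearMap.comp_apply, LinearMap.id_apply]
  rw [← realize_vertices, subdiv_realize, boundary_realize, subdivHomotopy_realize,
    subdivHomotopy_realize, boundary_realize, ← map_add, ← map_sub, tupleBoundary_tupleHomotopy]

variable (X) in
/-- The chain homotopy from the identity to the `m`-fold barycentric subdivision. -/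
def iterSubdivHomotopy (n m : ℕ) : Chain X n →ₗ[ℤ] Chain X (n + 1) :=
  ∑ i ∈ Finset.range m, subdivHomotopy X n ∘ₗ subdiv X n ^ i

theorem boundary_subdiv_pow (n m : ℕ) (c : Chain X (n + 1)) :
    boundary X n ((subdiv X (n + 1) ^ m) c) = (subdiv X n ^ m) (boundary X n c) := by
  induction m with
  | zero => rfl
  | succ m ih =>
    rw [pow_succ', Module.End.mul_apply, boundary_subdiv, ih, pow_succ', Module.End.mul_apply]

/-- Apply the homotopy formula to the iterates `Sⁱ c`, which commute with the boundary; the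
right-hand sides telescope. -/
theorem boundary_iterSubdivHomotopy (n m : ℕ) (c : Chain X (n + 1)) :
    boundary X (n + 1) (iterSubdivHomotopy X (n + 1) m c) +
      iterSubdivHomotopy X n m (boundary X n c) = c - (subdiv X (n + 1) ^ m) c := by
  simp only [iterSubdivHomotopy, LinearMap.sum_apply, LinearMap.comp_apply, map_sum]
  rw [← Finset.sum_add_distrib]
  simp only [← boundary_subdiv_pow, boundary_subdivHomotopy]
  refine (Finset.sum_congr rfl fun i _ => ?_).trans
    (Finset.sum_range_sub' (fun i => (subdiv X (n + 1) ^ i) c) m)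
  rw [pow_succ', Module.End.mul_apply]

/-! ## Small chains -/

/-- The singular simplices whose image lies in a member of `𝒰`. -/
def smallSimplices (𝒰 : Set (Set X)) (n : ℕ) : Set C(Simplex n, X) :=
  {σ | ∃ U ∈ 𝒰, ∀ t, σ t ∈ U}

/-- The chains of singular simplices whose images lie in members of `𝒰`. -/
def smallChains (𝒰 : Set (Set X)) (n : ℕ) : Submodule ℤ (Chain X n) :=
  Finsupp.supported ℤ ℤ (smallSimplices 𝒰 n)

variable {𝒰 : Set (Set X)} {n : ℕ}

theorem comp_mem_smallSimplices {k : ℕ} {σ : C(Simplex n, X)} (hσ : σ ∈ smallSimplices 𝒰 n)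
    (f : C(Simplex k, Simplex n)) : σ.comp f ∈ smallSimplices 𝒰 k := by
  obtain ⟨U, hU, h⟩ := hσ
  exact ⟨U, hU, fun t => h _⟩

theorem realize_mem_smallChains {σ : C(Simplex n, X)} (hσ : σ ∈ smallSimplices 𝒰 n) (k : ℕ)
    (c : TupleChain (Simplex n) (k + 1)) : realize σ k c ∈ smallChains 𝒰 k := by
  have hc : c ∈ Finsupp.supported ℤ ℤ (Set.univ : Set (Fin (k + 1) → Simplex n)) := by simp
  refine map_mem_of_mem_supported _ (fun w _ => ?_) hc
  rw [realize_single]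
  exact Finsupp.single_mem_supported ℤ _ (comp_mem_smallSimplices hσ _)

theorem subdiv_mem_smallChains {c : Chain X n} (hc : c ∈ smallChains 𝒰 n) :
    subdiv X n c ∈ smallChains 𝒰 n := by
  refine map_mem_of_mem_supported _ (fun σ hσ => ?_) hc
  rw [subdiv_single]
  exact realize_mem_smallChains hσ _ _

theorem subdivHomotopy_mem_smallChains {c : Chain X n} (hc : c ∈ smallChains 𝒰 n) :
    subdivHomotopy X n c ∈ smallChains 𝒰 (n + 1) := by
  refine map_mem_of_mem_supported _ (fun σ hσ => ?_) hc
  rw [subdivHomotopy_single]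
  exact realize_mem_smallChains hσ _ _

theorem subdiv_pow_mem_smallChains {c : Chain X n} {p q : ℕ} (hpq : p ≤ q)
    (hc : (subdiv X n ^ p) c ∈ smallChains 𝒰 n) : (subdiv X n ^ q) c ∈ smallChains 𝒰 n := by
  induction q, hpq using Nat.le_induction with
  | base => exact hc
  | succ q _ ih =>
    rw [pow_succ', Module.End.mul_apply]
    exact subdiv_mem_smallChains ih

/-- The difference only involves the iterates `Sⁱ c` with `p ≤ i < q`, which are already small. This
compares the homotopy used for a simplex with the one used for its faces. -/
theorem iterSubdivHomotopy_sub_mem_smallChains {c : Chain X n} {p q : ℕ} (hpq : p ≤ q)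
    (hc : (subdiv X n ^ p) c ∈ smallChains 𝒰 n) :
    iterSubdivHomotopy X n q c - iterSubdivHomotopy X n p c ∈ smallChains 𝒰 (n + 1) := by
  rw [← LinearMap.sub_apply, iterSubdivHomotopy, iterSubdivHomotopy,
    ← Finset.sum_Ico_eq_sub _ hpq, LinearMap.sum_apply]
  refine Submodule.sum_mem _ fun i hi => subdivHomotopy_mem_smallChains ?_
  exact subdiv_pow_mem_smallChains (Finset.mem_Ico.1 hi).1 hc

/-- Every singular simplex becomes small after sufficiently many barycentric subdivisions. -/
theorem exists_subdiv_pow_mem_smallChains (h𝒰 : ∀ x, ∃ U ∈ 𝒰, U ∈ 𝓝 x) (σ : C(Simplex n, X)) :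
    ∃ m, (subdiv X n ^ m) (Finsupp.single σ 1) ∈ smallChains 𝒰 n := by
  obtain ⟨δ, hδ, hball⟩ := lebesgue_number_lemma_of_metric (s := (Set.univ : Set (Simplex n)))
    (c := fun U : 𝒰 => σ ⁻¹' interior U.1) isCompact_univ
    (fun U => isOpen_interior.preimage σ.continuous) (fun t _ => by
      obtain ⟨U, hU, hx⟩ := h𝒰 (σ t)
      exact Set.mem_iUnion.2 ⟨⟨U, hU⟩, mem_interior_iff_mem_nhds.2 hx⟩)
  -- Half the Lebesgue number: the pieces lie in closed balls of radius `δ / 2`, hence in the open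
  -- balls of radius `δ`.
  obtain ⟨m, hm⟩ := exists_tupleSubdiv_pow_mesh n (half_pos hδ)
  refine ⟨m, ?_⟩
  rw [← realize_vertices, subdiv_pow_realize]
  refine map_mem_of_mem_supported _ (fun w hw => ?_) hm
  rw [realize_single]
  obtain ⟨U, hU⟩ := hball (w 0) trivial
  refine Finsupp.single_mem_supported ℤ _ ⟨U.1, U.2, fun t => interior_subset (hU ?_)⟩
  exact (affineSimplex_mem_closedBall (fun i => (hw i 0).le) t).trans_lt (half_lt_self hδ)

open Classical in
/-- A number of subdivisions for each singular simplex, monotone under passage to faces and zero on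
small simplices, built from an arbitrary choice `M`. -/
def subdivOrder (𝒰 : Set (Set X)) (M : ∀ n, C(Simplex n, X) → ℕ) : ∀ n, C(Simplex n, X) → ℕ
  | 0 => fun σ => if σ ∈ smallSimplices 𝒰 0 then 0 else M 0 σ
  | n + 1 => fun σ => if σ ∈ smallSimplices 𝒰 (n + 1) then 0 else
      M (n + 1) σ ⊔ Finset.univ.sup fun i => subdivOrder 𝒰 M n (σ.comp (faceInclusion n i))

theorem subdivOrder_of_mem (M : ∀ n, C(Simplex n, X) → ℕ) {σ : C(Simplex n, X)}
    (hσ : σ ∈ smallSimplices 𝒰 n) : subdivOrder 𝒰 M n σ = 0 := by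
  cases n <;> simp [subdivOrder, hσ]

theorem le_subdivOrder_of_notMem (M : ∀ n, C(Simplex n, X) → ℕ) {σ : C(Simplex n, X)}
    (hσ : σ ∉ smallSimplices 𝒰 n) : M n σ ≤ subdivOrder 𝒰 M n σ := by
  cases n <;> simp [subdivOrder, hσ]

theorem subdivOrder_face_le (M : ∀ n, C(Simplex n, X) → ℕ) (σ : C(Simplex (n + 1), X))
    (i : Fin (n + 2)) :
    subdivOrder 𝒰 M n (σ.comp (faceInclusion n i)) ≤ subdivOrder 𝒰 M (n + 1) σ := by
  by_cases hσ : σ ∈ smallSimplices 𝒰 (n + 1)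
  · rw [subdivOrder_of_mem M (comp_mem_smallSimplices hσ _)]
    exact Nat.zero_le _
  · simp only [subdivOrder, if_neg hσ]
    exact le_sup_of_le_right (Finset.le_sup
      (f := fun i => subdivOrder 𝒰 M n (σ.comp (faceInclusion n i))) (Finset.mem_univ i))

/-- The theorem on small chains: if the interiors of the members of `𝒰` cover `X`, then the singular
chain complex is retracted by a deformation `D` onto the complex of small chains. -/
theorem exists_smallChains_retraction (h𝒰 : ∀ x, ∃ U ∈ 𝒰, U ∈ 𝓝 x) :
    ∃ D : ∀ n, Chain X n →ₗ[ℤ] Chain X (n + 1),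
      (∀ n, ∀ σ ∈ smallSimplices 𝒰 n, D n (Finsupp.single σ 1) = 0) ∧
      ∀ n c, c - boundary X (n + 1) (D (n + 1) c) - D n (boundary X n c) ∈
        smallChains 𝒰 (n + 1) := by
  choose M hM using fun n (σ : C(Simplex n, X)) => exists_subdiv_pow_mem_smallChains h𝒰 σ
  set N := subdivOrder 𝒰 M with hN
  have hsmall : ∀ n σ, (subdiv X n ^ N n σ) (Finsupp.single σ 1) ∈ smallChains 𝒰 n := by
    intro n σ
    by_cases hσ : σ ∈ smallSimplices 𝒰 n
    · rw [hN, subdivOrder_of_mem M hσ]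
      exact Finsupp.single_mem_supported ℤ _ hσ
    · exact subdiv_pow_mem_smallChains (le_subdivOrder_of_notMem M hσ) (hM n σ)
  let D : ∀ n, Chain X n →ₗ[ℤ] Chain X (n + 1) := fun n =>
    Finsupp.linearCombination ℤ fun σ => iterSubdivHomotopy X n (N n σ) (Finsupp.single σ 1)
  have hD : ∀ n σ, D n (Finsupp.single σ 1) =
      iterSubdivHomotopy X n (N n σ) (Finsupp.single σ 1) := fun n σ => by simp [D]
  refine ⟨D, fun n σ hσ => ?_, fun n c => ?_⟩
  · rw [hD, hN, subdivOrder_of_mem M hσ]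
    simp [iterSubdivHomotopy]
  have hc : c ∈ Finsupp.supported ℤ ℤ (Set.univ : Set C(Simplex (n + 1), X)) := by simp
  refine map_mem_of_mem_supported
    (LinearMap.id - boundary X (n + 1) ∘ₗ D (n + 1) - D n ∘ₗ boundary X n) (fun σ _ => ?_) hc
  simp only [LinearMap.sub_apply, LinearMap.comp_apply, LinearMap.id_apply]
  have hsplit := boundary_iterSubdivHomotopy n (N (n + 1) σ) (Finsupp.single σ 1)
  -- With `N` subdivisions for `σ` and `T_N` the iterated homotopy, `σ - ∂Dσ - D∂σ = S^N σ + (T_N ∂σ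
  -- - D∂σ)`. The bracket is small since faces need at most `N` subdivisions.
  have hfaces : iterSubdivHomotopy X n (N (n + 1) σ) (boundary X n (Finsupp.single σ 1)) -
      D n (boundary X n (Finsupp.single σ 1)) ∈ smallChains 𝒰 (n + 1) := by
    simp only [boundary_single, map_sum, map_zsmul, ← Finset.sum_sub_distrib, ← smul_sub, hD]
    exact Submodule.sum_mem _ fun i _ => Submodule.smul_mem _ _
      (iterSubdivHomotopy_sub_mem_smallChains (subdivOrder_face_le M σ i) (hsmall n _))
  have := Submodule.add_mem _ (hsmall (n + 1) σ) hfaces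
  rw [hD]
  convert! this using 1
  rw [← sub_eq_zero] at hsplit ⊢
  rw [← neg_eq_zero, ← hsplit]
  abel

end subdivision

/-! ## Excision for singular cohomology -/

section excision

variable {X : Type u} {Y : Type v} [TopologicalSpace X] [TopologicalSpace Y]

theorem mem_smallSimplices_zero {𝒰 : Set (Set X)} (h𝒰 : ∀ x, ∃ U ∈ 𝒰, U ∈ 𝓝 x)
    (σ : C(Simplex 0, X)) : σ ∈ smallSimplices 𝒰 0 := by
  obtain ⟨U, hU, hx⟩ := h𝒰 (σ default)
  exact ⟨U, hU, fun t => by rw [Subsingleton.elim t default]; exact mem_of_mem_nhds hx⟩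

/-- The theorem on small chains, in terms of a chain map `ρ` onto small chains and a chain homotopy
`D` from the identity to `ρ`, both trivial on small simplices. -/
theorem exists_smallChains_chainMap {𝒰 : Set (Set X)} (h𝒰 : ∀ x, ∃ U ∈ 𝒰, U ∈ 𝓝 x) :
    ∃ (ρ : ∀ n, Chain X n →ₗ[ℤ] Chain X n) (D : ∀ n, Chain X n →ₗ[ℤ] Chain X (n + 1)),
      (∀ n c, ρ n c ∈ smallChains 𝒰 n) ∧
      (∀ n, ∀ σ ∈ smallSimplices 𝒰 n, ρ n (Finsupp.single σ 1) = Finsupp.single σ 1) ∧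
      (∀ n, ∀ σ ∈ smallSimplices 𝒰 n, D n (Finsupp.single σ 1) = 0) ∧
      (∀ n c, boundary X n (ρ (n + 1) c) = ρ n (boundary X n c)) ∧
      ∀ n c, ρ (n + 1) c = c - boundary X (n + 1) (D (n + 1) c) - D n (boundary X n c) := by
  obtain ⟨D, hD, hsmall⟩ := exists_smallChains_retraction h𝒰
  have hD0 : D 0 = 0 := chain_hom_ext fun σ => hD 0 σ (mem_smallSimplices_zero h𝒰 σ)
  have hbb : ∀ n c, boundary X n (boundary X (n + 1) c) = 0 := fun n c =>
    LinearMap.congr_fun (boundary_comp_boundary n) c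
  -- Degree zero has no boundary term. The identity fits there because points are always small, so
  -- `D 0 = 0`.
  let ρ : ∀ n, Chain X n →ₗ[ℤ] Chain X n
    | 0 => LinearMap.id
    | n + 1 => LinearMap.id - boundary X (n + 1) ∘ₗ D (n + 1) - D n ∘ₗ boundary X n
  have hρ : ∀ n c, ρ (n + 1) c = c - boundary X (n + 1) (D (n + 1) c) - D n (boundary X n c) :=
    fun n c => rfl
  have hρ0 : ∀ c, ρ 0 c = c := fun c => rfl
  refine ⟨ρ, D, fun n c => ?_, fun n σ hσ => ?_, hD, fun n c => ?_, hρ⟩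
  · cases n with
    | zero => exact (Finsupp.mem_supported ℤ _).2 fun σ _ => mem_smallSimplices_zero h𝒰 σ
    | succ n => exact hsmall n c
  · cases n with
    | zero => rfl
    | succ n =>
      have h : D n (boundary X n (Finsupp.single σ 1)) = 0 := by
        rw [boundary_single, map_sum]
        refine Finset.sum_eq_zero fun i _ => ?_
        rw [map_zsmul, hD n _ (comp_mem_smallSimplices hσ _), smul_zero]
      rw [hρ, hD _ σ hσ, h, map_zero, sub_zero, sub_zero]
  · rw [hρ, map_sub, map_sub, hbb, sub_zero]
    cases n with
    | zero => rw [hρ0, hD0, LinearMap.zero_apply, map_zero, sub_zero]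
    | succ n => rw [hρ, hbb, map_zero, sub_zero]

/-! ### Extension of cochains by zero and the excision isomorphism -/

variable {G : Type w} [AddCommGroup G] {n : ℕ}

open Classical in
/-- The extension by zero of a cochain on `Y` along a map `f : Y → X`. -/
def extendCochain (f : C(Y, X)) (φ : Chain Y n →ₗ[ℤ] G) : Chain X n →ₗ[ℤ] G :=
  Finsupp.linearCombination ℤ fun σ =>
    if h : ∃ τ : C(Simplex n, Y), f.comp τ = σ then φ (Finsupp.single h.choose 1) else 0

theorem extendCochain_single_comp {f : C(Y, X)} (hf : Function.Injective f)
    (φ : Chain Y n →ₗ[ℤ] G) (τ : C(Simplex n, Y)) :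
    extendCochain f φ (Finsupp.single (f.comp τ) 1) = φ (Finsupp.single τ 1) := by
  have h : ∃ τ' : C(Simplex n, Y), f.comp τ' = f.comp τ := ⟨τ, rfl⟩
  have h' : h.choose = τ :=
    ContinuousMap.ext fun t => hf (ContinuousMap.congr_fun h.choose_spec t)
  rw [extendCochain, Finsupp.linearCombination_single, one_smul, dif_pos h, h']

theorem extendCochain_zero (f : C(Y, X)) : extendCochain f (0 : Chain Y n →ₗ[ℤ] G) = 0 :=
  chain_hom_ext fun σ => by simp [extendCochain]

theorem extendCochain_mem {A : Set X} (f : C(Y, X)) {φ : Chain Y n →ₗ[ℤ] G}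
    (hφ : φ ∈ cochain Y (f ⁻¹' A) G n) : extendCochain f φ ∈ cochain X A G n := by
  intro σ hσ
  rw [extendCochain, Finsupp.linearCombination_single, one_smul]
  split_ifs with h
  · refine hφ _ fun t => ?_
    rw [Set.mem_preimage, ← ContinuousMap.comp_apply, h.choose_spec]
    exact hσ t
  · rfl

/-- Cochains of `(X, A)` agreeing on the simplices of the subspace `Y` agree on all chains of
simplices lying in `A` or in `Y`. -/
theorem cochain_eq_of_mem_smallChains {A : Set X} {f : C(Y, X)} (hf : IsEmbedding f)
    {φ ψ : Chain X n →ₗ[ℤ] G} (hφ : φ ∈ cochain X A G n) (hψ : ψ ∈ cochain X A G n)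
    (h : ∀ τ : C(Simplex n, Y),
      φ (Finsupp.single (f.comp τ) 1) = ψ (Finsupp.single (f.comp τ) 1))
    {c : Chain X n} (hc : c ∈ smallChains {A, Set.range f} n) : φ c = ψ c := by
  rw [← sub_eq_zero, ← LinearMap.sub_apply, ← Submodule.mem_bot ℤ]
  refine map_mem_of_mem_supported _ ?_ hc
  rintro σ ⟨U, rfl | rfl, hσ⟩
  · simp [hφ σ hσ, hψ σ hσ]
  · choose τ hτ using hσ
    have hcont : Continuous τ := hf.continuous_iff.2 (by
      rw [show f ∘ τ = σ from funext hτ]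
      exact σ.continuous)
    have hστ : f.comp ⟨τ, hcont⟩ = σ := ContinuousMap.ext hτ
    rw [Submodule.mem_bot, LinearMap.sub_apply, ← hστ, h, sub_self]

/-- Extension by zero does not commute with the coboundary in general, since a simplex outside `Y`
may have faces in `Y`. On small chains it does: both sides are relative cochains agreeing on
simplices of `Y`. -/
theorem extendCochain_boundary {A : Set X} {f : C(Y, X)} (hf : IsEmbedding f)
    {φ : Chain Y n →ₗ[ℤ] G} (hφ : φ ∈ cochain Y (f ⁻¹' A) G n) {c : Chain X (n + 1)}
    (hc : c ∈ smallChains {A, Set.range f} (n + 1)) :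
    extendCochain f φ (boundary X n c) = extendCochain f (φ ∘ₗ boundary Y n) c := by
  refine cochain_eq_of_mem_smallChains hf (comp_boundary_mem (extendCochain_mem f hφ))
    (extendCochain_mem f (comp_boundary_mem hφ)) (fun τ => ?_) hc
  rw [extendCochain_single_comp hf.injective]
  simp only [LinearMap.comp_apply, boundary_single, map_sum, map_zsmul, ContinuousMap.comp_assoc,
    extendCochain_single_comp hf.injective]

/-- **Excision** for singular cohomology: if the interiors of `A` and of the subspace `Y` cover `X`,
then the inclusion `(Y, Y ∩ A) → (X, A)` induces isomorphisms on relative cohomology. -/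
theorem cohomologyMap_bijective_of_isEmbedding {A : Set X} {f : C(Y, X)} (hf : IsEmbedding f)
    (hA : ∀ x, A ∈ 𝓝 x ∨ Set.range f ∈ 𝓝 x) (G : Type w) [AddCommGroup G] (n : ℕ) :
    Function.Bijective (cohomologyMap f (Set.mapsTo_preimage f A) G n) := by
  have h𝒰 : ∀ x, ∃ U ∈ ({A, Set.range f} : Set (Set X)), U ∈ 𝓝 x := fun x =>
    (hA x).elim (fun h => ⟨A, by simp, h⟩) fun h => ⟨Set.range f, by simp, h⟩
  obtain ⟨ρ, D, hρ, hρσ, hDσ, hρb, hρD⟩ := exists_smallChains_chainMap h𝒰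
  have hAsmall : ∀ {n} {σ : C(Simplex n, X)}, (∀ t, σ t ∈ A) →
      σ ∈ smallSimplices {A, Set.range f} n := fun h => ⟨A, by simp, h⟩
  have hfsmall : ∀ {n} (τ : C(Simplex n, Y)), f.comp τ ∈ smallSimplices {A, Set.range f} n :=
    fun τ => ⟨Set.range f, by simp, fun t => ⟨τ t, rfl⟩⟩
  have hmem : ∀ {n} {φ : Chain Y n →ₗ[ℤ] G}, φ ∈ cochain Y (f ⁻¹' A) G n →
      extendCochain f φ ∘ₗ ρ n ∈ cochain X A G n := by
    intro n φ hφ σ hσ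
    rw [LinearMap.comp_apply, hρσ n σ (hAsmall hσ), extendCochain_mem f hφ σ hσ]
  have hcob : ∀ {n} {φ : Chain Y n →ₗ[ℤ] G}, φ ∈ cochain Y (f ⁻¹' A) G n → ∀ c,
      extendCochain f φ (ρ n (boundary X n c)) =
        extendCochain f (φ ∘ₗ boundary Y n) (ρ (n + 1) c) := fun hφ c => by
    rw [← hρb, extendCochain_boundary hf hφ (hρ _ _)]
  constructor
  · refine (injective_iff_map_eq_zero _).2 fun x hx => ?_
    obtain ⟨⟨⟨φ, hφ⟩, hφc⟩, rfl⟩ := Submodule.Quotient.mk_surjective _ x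
    have hδ : φ ∘ₗ boundary X n = 0 := congrArg Subtype.val hφc
    refine (Submodule.Quotient.mk_eq_zero _).2 ?_
    replace hx : cochainMap f (Set.mapsTo_preimage f A) G n ⟨φ, hφ⟩ ∈
        coboundaries Y (f ⁻¹' A) G n :=
      (Submodule.Quotient.mk_eq_zero ((coboundaries Y (f ⁻¹' A) G n).submoduleOf _)
        (x := cocyclesMap f (Set.mapsTo_preimage f A) G n ⟨⟨φ, hφ⟩, hφc⟩)).1 hx
    change (⟨φ, hφ⟩ : cochain X A G n) ∈ coboundaries X A G n
    cases n with
    | zero =>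
      -- Zero is the only coboundary in degree zero, so `φ` itself must vanish; all `0`-simplices
      -- being small, it suffices to test it on `Y`.
      have h0 : φ ∘ₗ chainMap f 0 = 0 := congrArg Subtype.val hx
      refine Subtype.ext (chain_hom_ext fun σ => ?_)
      refine cochain_eq_of_mem_smallChains hf hφ (zero_mem _) (fun τ => ?_)
        (Finsupp.single_mem_supported ℤ _ (mem_smallSimplices_zero h𝒰 σ))
      rw [← chainMap_single, ← LinearMap.comp_apply, h0]
      rfl
    | succ n =>
      obtain ⟨⟨ξ, hξ⟩, hξφ⟩ := hx
      replace hξφ : ξ ∘ₗ boundary Y n = φ ∘ₗ chainMap f (n + 1) := congrArg Subtype.val hξφ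
      have hφD : φ ∘ₗ D n ∈ cochain X A G n := fun σ hσ => by
        rw [LinearMap.comp_apply, hDσ n σ (hAsmall hσ), map_zero]
      -- Since `φ ∂ = 0`, composing the homotopy formula with `φ` gives `φ = φ ρ + φ D ∂`. On small
      -- chains `φ` is the extension of `δξ`, so `φ ρ` is the coboundary of the extension of `ξ`
      -- composed with `ρ`.
      refine ⟨⟨φ ∘ₗ D n + extendCochain f ξ ∘ₗ ρ n, add_mem hφD (hmem hξ)⟩,
        Subtype.ext (LinearMap.ext fun c => ?_)⟩
      have hsmall : extendCochain f (ξ ∘ₗ boundary Y n) (ρ (n + 1) c) = φ (ρ (n + 1) c) := by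
        refine cochain_eq_of_mem_smallChains hf (extendCochain_mem f (comp_boundary_mem hξ)) hφ
          (fun τ => ?_) (hρ _ _)
        rw [extendCochain_single_comp hf.injective, hξφ, LinearMap.comp_apply, chainMap_single]
      change φ (D n (boundary X n c)) + extendCochain f ξ (ρ n (boundary X n c)) = φ c
      rw [hcob hξ, hsmall, hρD, map_sub, map_sub, ← LinearMap.comp_apply φ (boundary X (n + 1)), hδ,
        LinearMap.zero_apply]
      abel
  · intro x
    obtain ⟨⟨⟨φ, hφ⟩, hφc⟩, rfl⟩ := Submodule.Quotient.mk_surjective _ x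
    have hδ : φ ∘ₗ boundary Y n = 0 := congrArg Subtype.val hφc
    refine ⟨Submodule.Quotient.mk ⟨⟨extendCochain f φ ∘ₗ ρ n, hmem hφ⟩, ?_⟩, ?_⟩
    · refine Subtype.ext (LinearMap.ext fun c => ?_)
      change extendCochain f φ (ρ n (boundary X n c)) = 0
      rw [hcob hφ, hδ, extendCochain_zero, LinearMap.zero_apply]
    -- The restriction is `φ` already as a cochain, because `ρ` fixes the simplices of `Y`.
    · refine congrArg Submodule.Quotient.mk (Subtype.ext (Subtype.ext (chain_hom_ext fun τ => ?_)))
      change extendCochain f φ (ρ n (chainMap f n (Finsupp.single τ 1))) = φ (Finsupp.single τ 1)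
      rw [chainMap_single, hρσ n _ (hfsmall τ), extendCochain_single_comp hf.injective]

end excision

end Singular

/-! ## Excision for CH-shape cohomology -/

namespace CHShape

open Singular CompactSubpair

universe u v w

/-! ### Compact subpairs to which singular excision applies -/

namespace CompactSubpair

variable {X : Type u} [TopologicalSpace X] {X₀ W : Set X}

/-- The compact subpair `(K ∖ W, K₀ ∖ W)` of `(X ∖ W, X₀ ∖ W)`. -/
def diff (hW : IsOpen W) (a : CompactSubpair X X₀) :
    CompactSubpair (Wᶜ : Set X) (Subtype.val ⁻¹' (X₀ \ W)) where
  K := Subtype.val ⁻¹' a.K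
  K₀ := Subtype.val ⁻¹' a.K₀
  isCompact := hW.isClosed_compl.isClosedEmbedding_subtypeVal.isCompact_preimage a.isCompact
  isCompact₀ := hW.isClosed_compl.isClosedEmbedding_subtypeVal.isCompact_preimage a.isCompact₀
  subset := Set.preimage_mono a.subset
  subset₀ := fun x hx => ⟨a.subset₀ hx, x.2⟩

/-- The inclusion `K ∖ W → K`. -/
def diffIncl (hW : IsOpen W) (a : CompactSubpair X X₀) : C((a.diff hW).K, a.K) :=
  ⟨fun x => ⟨x.1.1, x.2⟩,
    (continuous_subtype_val.comp continuous_subtype_val).subtype_mk _⟩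

theorem diff_mono (hW : IsOpen W) {a b : CompactSubpair X X₀} (h : a ≤ b) :
    a.diff hW ≤ b.diff hW :=
  ⟨Set.preimage_mono h.1, Set.preimage_mono h.2⟩

theorem diffIncl_mapsTo (hW : IsOpen W) (a : CompactSubpair X X₀) :
    Set.MapsTo (a.diffIncl hW) (a.diff hW).sub a.sub :=
  fun _ hx => hx

theorem isEmbedding_diffIncl (hW : IsOpen W) (a : CompactSubpair X X₀) :
    IsEmbedding (a.diffIncl hW) :=
  IsEmbedding.of_comp (a.diffIncl hW).continuous continuous_subtype_val
    (IsEmbedding.subtypeVal.comp IsEmbedding.subtypeVal :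
      IsEmbedding ((Subtype.val : (Wᶜ : Set X) → X) ∘ (Subtype.val : (a.diff hW).K → _)))

theorem diff_map_le (hW : IsOpen W) (a : CompactSubpair X X₀) :
    (a.diff hW).map (complInclusion W) (complInclusion_mapsTo W X₀) ≤ a :=
  ⟨Set.image_preimage_subset _ _, Set.image_preimage_subset _ _⟩

/-- Applied with `b` the image of `a`, this shows that the subpairs `b.diff hW` are cofinal among
those of `X ∖ W`. -/
theorem le_diff_of_map_le (hW : IsOpen W)
    {a : CompactSubpair (Wᶜ : Set X) (Subtype.val ⁻¹' (X₀ \ W))} {b : CompactSubpair X X₀}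
    (h : a.map (complInclusion W) (complInclusion_mapsTo W X₀) ≤ b) : a ≤ b.diff hW :=
  ⟨Set.image_subset_iff.1 h.1, Set.image_subset_iff.1 h.2⟩

/-- In a compact subpair `(K, K₀)` adapted to `W`, the set `K ∩ closure W` lies in the interior of
`K₀` relative to `K`. -/
def IsAdapted (W : Set X) (a : CompactSubpair X X₀) : Prop :=
  ∀ x : a.K, x.1 ∈ closure W → a.sub ∈ 𝓝 x

/-- Normality of the compact Hausdorff space `K` yields `V` between `K ∩ closure W` and `K ∩
interior X₀`, with closure still in the latter; adjoining the compact set `closure V` to `K₀`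
suffices. The Hausdorff hypothesis enters the proof only here. -/
theorem exists_isAdapted_ge [T2Space X] (hWX₀ : closure W ⊆ interior X₀)
    (a : CompactSubpair X X₀) : ∃ b : CompactSubpair X X₀, a ≤ b ∧ b.IsAdapted W := by
  have : CompactSpace a.K := isCompact_iff_compactSpace.1 a.isCompact
  obtain ⟨V, hVo, hWV, hVX₀⟩ := normal_exists_closure_subset
    (isClosed_closure.preimage continuous_subtype_val :
      IsClosed ((Subtype.val : a.K → X) ⁻¹' closure W))
    (isOpen_interior.preimage continuous_subtype_val :
      IsOpen ((Subtype.val : a.K → X) ⁻¹' interior X₀))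
    (Set.preimage_mono hWX₀)
  refine ⟨⟨a.K, a.K₀ ∪ Subtype.val '' closure V, a.isCompact,
    a.isCompact₀.union (isClosed_closure.isCompact.image continuous_subtype_val),
    Set.union_subset a.subset (Subtype.coe_image_subset _ _), Set.union_subset a.subset₀ ?_⟩,
    ⟨subset_rfl, Set.subset_union_left⟩, fun x hx => ?_⟩
  · rintro _ ⟨x, hx, rfl⟩
    exact interior_subset (hVX₀ hx)
  · exact Filter.mem_of_superset (hVo.mem_nhds (hWV hx)) fun y hy =>
      Or.inr ⟨y, subset_closure hy, rfl⟩

/-- Adaptedness covers the points of `closure W`; any other point of `K` has the neighbourhood `K ∖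
closure W`, which lies in `K ∖ W`. -/
theorem IsAdapted.cohomologyMap_bijective (hW : IsOpen W) {a : CompactSubpair X X₀}
    (ha : a.IsAdapted W) (G : Type w) [AddCommGroup G] (n : ℕ) :
    Function.Bijective (cohomologyMap (a.diffIncl hW) (a.diffIncl_mapsTo hW) G n) := by
  refine cohomologyMap_bijective_of_isEmbedding (a.isEmbedding_diffIncl hW) (fun x => ?_) G n
  refine or_iff_not_imp_left.2 fun hx => ?_
  have hxW : x.1 ∈ (closure W)ᶜ := fun h => hx (ha x h)
  refine Filter.mem_of_superset
    ((isClosed_closure.isOpen_compl.preimage continuous_subtype_val).mem_nhds hxW) fun y hy => ?_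
  exact ⟨⟨⟨y.1, fun h => hy (subset_closure h)⟩, y.2⟩, rfl⟩

end CompactSubpair

/-! ### Passage to the inverse limit -/

section

variable {X : Type u} [TopologicalSpace X] {X₀ W : Set X} {G : Type w} [AddCommGroup G] {n : ℕ}

theorem cohomologyMap_incl_incl {a b c : CompactSubpair X X₀} (hab : a ≤ b) (hbc : b ≤ c)
    (x : Cohomology c.K c.sub G n) :
    cohomologyMap (incl hab) (incl_mapsTo hab) G n
        (cohomologyMap (incl hbc) (incl_mapsTo hbc) G n x) =
      cohomologyMap (incl (hab.trans hbc)) (incl_mapsTo (hab.trans hbc)) G n x :=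
  (cohomologyMap_comp _ _ _ _ G n x).symm

theorem cohomologyMap_incl_diffIncl (hW : IsOpen W) {a b : CompactSubpair X X₀} (h : a ≤ b)
    (x : Cohomology b.K b.sub G n) :
    cohomologyMap (a.diffIncl hW) (a.diffIncl_mapsTo hW) G n
        (cohomologyMap (incl h) (incl_mapsTo h) G n x) =
      cohomologyMap (incl (diff_mono hW h)) (incl_mapsTo (diff_mono hW h)) G n
        (cohomologyMap (b.diffIncl hW) (b.diffIncl_mapsTo hW) G n x) := by
  rw [← cohomologyMap_comp, ← cohomologyMap_comp]
  rfl

theorem cohomologyMap_restr_incl (hW : IsOpen W)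
    {a : CompactSubpair (Wᶜ : Set X) (Subtype.val ⁻¹' (X₀ \ W))} {b : CompactSubpair X X₀}
    (h : a.map (complInclusion W) (complInclusion_mapsTo W X₀) ≤ b)
    (x : Cohomology b.K b.sub G n) :
    cohomologyMap (restr (complInclusion W) (complInclusion_mapsTo W X₀) a)
        (restr_mapsTo _ _ a) G n (cohomologyMap (incl h) (incl_mapsTo h) G n x) =
      cohomologyMap (incl (le_diff_of_map_le hW h)) (incl_mapsTo (le_diff_of_map_le hW h)) G n
        (cohomologyMap (b.diffIncl hW) (b.diffIncl_mapsTo hW) G n x) := by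
  rw [← cohomologyMap_comp, ← cohomologyMap_comp]
  rfl

theorem map_complInclusion_diff (hW : IsOpen W) (x : cohomology X X₀ G n)
    (a : CompactSubpair X X₀) :
    (map (complInclusion W) (complInclusion_mapsTo W X₀) G n x).1 (a.diff hW) =
      cohomologyMap (a.diffIncl hW) (a.diffIncl_mapsTo hW) G n (x.1 a) := by
  change cohomologyMap (restr (complInclusion W) (complInclusion_mapsTo W X₀) (a.diff hW))
    (restr_mapsTo _ _ (a.diff hW)) G n (x.1 _) = _
  rw [← x.2 _ _ (a.diff_map_le hW), ← cohomologyMap_comp]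
  rfl

/-- A family in the kernel vanishes at adapted subpairs by singular excision, and hence everywhere
by cofinality. -/
theorem map_complInclusion_injective [T2Space X] (hW : IsOpen W)
    (hWX₀ : closure W ⊆ interior X₀) :
    Function.Injective (map (complInclusion W) (complInclusion_mapsTo W X₀) G n) := by
  refine (injective_iff_map_eq_zero _).2 fun x hx => Subtype.ext (funext fun a => ?_)
  obtain ⟨b, hab, hb⟩ := exists_isAdapted_ge hWX₀ a
  have hxb := map_complInclusion_diff hW x b
  rw [hx] at hxb
  have : x.1 b = 0 := (hb.cohomologyMap_bijective hW G n).1 (hxb.symm.trans (map_zero _).symm)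
  rw [← x.2 a b hab, this, map_zero]
  rfl

theorem map_complInclusion_surjective [T2Space X] (hW : IsOpen W)
    (hWX₀ : closure W ⊆ interior X₀) :
    Function.Surjective (map (complInclusion W) (complInclusion_mapsTo W X₀) G n) := by
  intro y
  choose z hz using fun (b : CompactSubpair X X₀) (hb : b.IsAdapted W) =>
    (hb.cohomologyMap_bijective hW G n).2 (y.1 (b.diff hW))
  choose g hag hg using exists_isAdapted_ge (X₀ := X₀) hWX₀
  -- The lifts `z` exist only over adapted subpairs. They are compatible because each is the unique
  -- lift of a component of the compatible family `y`.
  have hzc : ∀ b c hb hc (h : b ≤ c), cohomologyMap (incl h) (incl_mapsTo h) G n (z c hc) =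
      z b hb := fun b c hb hc h => by
    apply (hb.cohomologyMap_bijective hW G n).1
    rw [cohomologyMap_incl_diffIncl, hz, hz]
    exact y.2 _ _ _
  refine ⟨⟨fun a => cohomologyMap (incl (hag a)) (incl_mapsTo (hag a)) G n (z (g a) (hg a)),
    fun a b h => ?_⟩, Subtype.ext (funext fun a => ?_)⟩
  -- The choice `g` need not be monotone, so `g a` and `g b` are compared inside the adapted subpair
  -- `g c` above both.
  · obtain ⟨c, hac, hbc⟩ := exists_ge_ge (g a) (g b)
    dsimp only
    rw [← hzc _ _ (hg a) (hg c) (hac.trans (hag c)),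
      ← hzc _ _ (hg b) (hg c) (hbc.trans (hag c)), cohomologyMap_incl_incl,
      cohomologyMap_incl_incl, cohomologyMap_incl_incl]
  · refine (cohomologyMap_restr_incl hW
      (hag (a.map (complInclusion W) (complInclusion_mapsTo W X₀))) _).trans ?_
    rw [hz]
    exact y.2 _ _ _

end

end CHShape

end

theorem mainTheorem5 {X : Type*} [TopologicalSpace X] [T2Space X] (X₀ W : Set X)
    (hW : IsOpen W) (hWX₀ : closure W ⊆ interior X₀)
    (G : Type*) [AddCommGroup G] (n : ℕ) :
    Function.Bijective
      (CHShape.map (CHShape.complInclusion W) (CHShape.complInclusion_mapsTo W X₀) G n :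
        CHShape.cohomology X X₀ G n →+
          CHShape.cohomology (Wᶜ : Set X) (Subtype.val ⁻¹' (X₀ \ W)) G n) :=
  ⟨CHShape.map_complInclusion_injective hW hWX₀, CHShape.map_complInclusion_surjective hW hWX₀⟩
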